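/- Graphs are finite, have at least one vertex, and may have parallel edges and loops; the degree of a vertex is the number of edges incident with it, loops counted twice, and a graph is $k$-regular if every vertex has degree $k$. A cycle is a (finite) connected $2$-regular graph (so two parallel edges together with their ends form a cycle), and a cycle of $G$ is a subgraph of $G$ that is a cycle. For distinct vertices $x,y$, $\lambda(x,y)$ denotes the maximum number of pairwise edge-disjoint paths from $x$ to $y$. Two edges are adjacent if they are distinct and share an endpoint. Theorem. Let $k>1$ be an integer. Let $G=(V,E)$ be a $k$-regular graph with a fixed-point-free involution $\mu:V\to V$ such that $\lambda(v,\mu(v))=k$ for every vertex $v\in V$. Then there exist a nonempty finite list of cycles of $G$ (repetitions allowed) and positive integers $m_1,m_2$ such that every edge of $G$ is contained in exactly $m_1$ cycles in the list, and for every pair of adjacent edges $e,f$ of $G$ exactly $m_2$ cycles in the list contain both $e$ and $f$. -/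

import Mathlib

open scoped Graph

namespace Graph

/-- The degree of the vertex `v` in a multigraph: the number of edges incident with `v`, where
loops are counted twice. -/
noncomputable def degree {α β : Type*} (G : Graph α β) (v : α) : ℕ∞ :=
  (G.incidenceSet v).encard + (G.loopSet v).encard

/-- `G` is `k`-regular: every vertex has degree `k`. -/
def IsRegular {α β : Type*} (G : Graph α β) (k : ℕ) : Prop :=
  ∀ v ∈ V(G), G.degree v = k

/-- `G` is connected: it has a vertex, and any two vertices are joined by a sequence of
successively adjacent vertices. -/
def IsConnected {α β : Type*} (G : Graph α β) : Prop :=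
  V(G).Nonempty ∧ ∀ x ∈ V(G), ∀ y ∈ V(G), Relation.ReflTransGen G.Adj x y

/-- A cycle is a finite connected `2`-regular graph. (A single vertex with a loop, and two vertices
joined by two parallel edges, are cycles.) -/
def IsCycle {α β : Type*} (C : Graph α β) : Prop :=
  V(C).Finite ∧ C.IsConnected ∧ C.IsRegular 2

/-- Walks from `x` to `y` in a multigraph, recording the edges that are traversed. -/
inductive Walk {α β : Type*} (G : Graph α β) : α → α → Type _
  | nil (x : α) (hx : x ∈ V(G)) : Walk G x x
  | cons {x y z : α} (e : β) (h : G.IsLink e x y) (p : Walk G y z) : Walk G x z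

/-- The list of vertices visited by a walk. -/
def Walk.vertices {α β : Type*} {G : Graph α β} : {x y : α} → G.Walk x y → List α
  | _, _, .nil x _ => [x]
  | x, _, .cons _ _ p => x :: p.vertices

/-- The list of edges traversed by a walk. -/
def Walk.edges {α β : Type*} {G : Graph α β} : {x y : α} → G.Walk x y → List β
  | _, _, .nil _ _ => []
  | _, _, .cons e _ p => e :: p.edges

/-- A path is a walk without repeated vertices. -/
def Walk.IsPath {α β : Type*} {G : Graph α β} {x y : α} (p : G.Walk x y) : Prop :=
  p.vertices.Nodup

/-- There are `m` pairwise edge-disjoint paths from `x` to `y` in `G`. -/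
def HasEdgeDisjointPaths {α β : Type*} (G : Graph α β) (x y : α) (m : ℕ) : Prop :=
  ∃ P : Fin m → G.Walk x y, (∀ i, (P i).IsPath) ∧
    ∀ i j, i ≠ j → List.Disjoint (P i).edges (P j).edges

/-- The local edge-connectivity `λ(x, y)` of two distinct vertices: the maximum number of pairwise
edge-disjoint paths from `x` to `y`. -/
noncomputable def localEdgeConnectivity {α β : Type*} (G : Graph α β) (x y : α) : ℕ∞ :=
  ⨆ (m : ℕ) (_ : G.HasEdgeDisjointPaths x y m), (m : ℕ∞)

/-- Two edges are adjacent: they are distinct and share an endpoint. (Parallel edges are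
adjacent.) -/
def EdgeAdj {α β : Type*} (G : Graph α β) (e f : β) : Prop :=
  e ≠ f ∧ ∃ v, G.Inc e v ∧ G.Inc f v

open Classical in
/-- The number of members of the list `L`, with multiplicity, that contain all edges in `F`. -/
noncomputable def countContaining {α β : Type*} (L : List (Graph α β)) (F : Set β) : ℕ :=
  L.countP (fun C => decide (F ⊆ E(C)))

end Graph

/-!
The cycles are obtained from perfect matchings. If `S` is an odd set of vertices, then the
fixed-point-free involution `μ` maps some `v ∈ S` out of `S`, and the `k` edge-disjoint paths from
`v` to `μ v` show that at least `k` edges leave `S`. So the `k`-regular graph `G` has no odd cut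
with fewer than `k` edges (and no loops, since the paths use up the degree of every vertex). By
Edmonds' description of the perfect matching polytope, there is a finite family of `T` perfect
matchings that covers every edge the same number `N > 0` of times
(`OddCutCondition.exists_uniform_family`, `Graph.exists_uniform_perfectMatchings`).

For every ordered pair `(M, M')` of members of this family, the nontrivial components of the
symmetric difference of `M` and `M'` are cycles (`Graph.IsTwoRegularEdgeSet.le_and_isCycle`), and
the list consists of all these cycles. Two adjacent edges `e`, `f` never lie in a common perfect
matching, so both lie in the symmetric difference exactly if one of the matchings contains `e` and
the other one `f`; since they share an end, they are then in the same component. This happens for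
`2 * N ^ 2` pairs. A single edge is in the symmetric difference for `2 * N * (T - N)` pairs, and
`T ≥ 2 * N` because two adjacent edges are never covered by the same matching.

Edmonds' theorem (`OddCutCondition.isMatchingCombination`) is proved for nonnegative rational
weightings with weight `r` at each vertex and at least `r` on each odd cut. By Tutte's theorem the
edges of positive weight contain a perfect matching (`OddCutCondition.exists_isPerfectMatching`).
Subtracting the largest admissible multiple of it either kills an edge, or makes an odd cut tight
whose two sides have at least two vertices. In the second case both sides are contracted in turn
and the two combinations obtained by induction are glued along the cut
(`isMatchingCombination_of_contract`).
-/

/-! ### Odd cuts and combinations of perfect matchings -/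

section PerfectMatchings

open Finset
open scoped Classical

universe u v

variable {V : Type u} {E : Type v} [Fintype E] {s t : E → V} {x : E → ℚ} {r : ℚ}

/-- The edges with exactly one end in `S`, in the multigraph on `V` in which the edge `e` joins
`s e` to `t e`. A loop belongs to no cut. -/
noncomputable def edgeCut (s t : E → V) (S : Finset V) : Finset E :=
  {e | ¬ (s e ∈ S ↔ t e ∈ S)}

/-- `M` is a perfect matching: every vertex is an end of exactly one non-loop edge of `M`. Loops
are allowed in `M` and have no influence, which is convenient when vertex sets are contracted. -/
def IsPerfectMatching (s t : E → V) (M : Finset E) : Prop :=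
  ∀ v, #(M ∩ edgeCut s t {v}) = 1

/-- The edge weighting `x` is nonnegative, has weight `r` at every vertex, and weight at least `r`
on every cut with an odd side. -/
structure OddCutCondition (s t : E → V) (x : E → ℚ) (r : ℚ) : Prop where
  nonneg : ∀ e, 0 ≤ x e
  degree : ∀ v, ∑ e ∈ edgeCut s t {v}, x e = r
  odd_cut : ∀ S : Finset V, Odd #S → r ≤ ∑ e ∈ edgeCut s t S, x e

/-- On non-loop edges, `x` is a nonnegative combination of indicators of perfect matchings. -/
def IsMatchingCombination (s t : E → V) (x : E → ℚ) : Prop :=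
  ∃ (ι : Type) (_ : Fintype ι) (M : ι → Finset E) (c : ι → ℚ), (∀ i, 0 ≤ c i) ∧
    (∀ i, IsPerfectMatching s t (M i)) ∧
    ∀ e, s e ≠ t e → x e = ∑ i with e ∈ M i, c i

lemma mem_edgeCut {S : Finset V} {e : E} : e ∈ edgeCut s t S ↔ ¬ (s e ∈ S ↔ t e ∈ S) := by
  simp [edgeCut]

lemma IsPerfectMatching.exists_forall_mem_iff {M : Finset E} (hM : IsPerfectMatching s t M)
    (v : V) : ∃ e, ∀ f, f ∈ M ∧ f ∈ edgeCut s t {v} ↔ f = e := by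
  obtain ⟨e, he⟩ := Finset.card_eq_one.1 (hM v)
  exact ⟨e, fun f => by rw [← mem_inter, he, mem_singleton]⟩

lemma sum_sum_edgeCut {κ : Type*} (C : Finset κ) (S : κ → Finset V) :
    ∑ c ∈ C, ∑ e ∈ edgeCut s t (S c), x e = ∑ e, x e * #{c ∈ C | e ∈ edgeCut s t (S c)} := by
  have (c : κ) : ∑ e ∈ edgeCut s t (S c), x e = ∑ e, if e ∈ edgeCut s t (S c) then x e else 0 := by
    simp
  simp_rw [this]
  rw [Finset.sum_comm]
  refine Finset.sum_congr rfl fun e _ => ?_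
  rw [← Finset.sum_filter]
  simp [mul_comm]

/-- If the sets `S c` are pairwise disjoint and disjoint from `U`, and `e` leaves every `S c` that
contains exactly one of its ends towards `U`, then `e` leaves at most one of the `S c`, and only if
it has exactly one end in `U`. -/
lemma card_filter_mem_edgeCut_le {κ : Type*} (C : Finset κ) (S : κ → Finset V) (U : Finset V)
    (hdisj : ∀ c c' p, p ∈ S c → p ∈ S c' → c = c') (hSU : ∀ c, ∀ p ∈ S c, p ∉ U) {e : E}
    (he : ∀ c p q, s(s e, t e) = s(p, q) → p ∈ S c → q ∉ S c → q ∈ U) :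
    #{c ∈ C | e ∈ edgeCut s t (S c)} ≤ #{v ∈ U | e ∈ edgeCut s t {v}} := by
  have aux (p q : V) (hpq : s(s e, t e) = s(p, q)) (c : κ) (hp : p ∈ S c) (hq : q ∉ S c) :
      #{c ∈ C | e ∈ edgeCut s t (S c)} ≤ #{v ∈ U | e ∈ edgeCut s t {v}} := by
    have hne : p ≠ q := by rintro rfl; exact hq hp
    have hqU : q ∈ U := he c p q hpq hp hq
    have h1 : #{c ∈ C | e ∈ edgeCut s t (S c)} ≤ 1 := by
      suffices ∀ c', e ∈ edgeCut s t (S c') → c' = c by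
        rw [Finset.card_le_one]
        intro a ha b hb
        rw [this a (mem_filter.1 ha).2, this b (mem_filter.1 hb).2]
      intro c' hc'
      have hq' : q ∉ S c' := fun hq' => hSU _ _ hq' hqU
      have hp' : p ∈ S c' := by
        rw [mem_edgeCut] at hc'
        rcases Sym2.eq_iff.1 hpq with ⟨h1, h2⟩ | ⟨h1, h2⟩ <;> rw [h1, h2] at hc' <;> tauto
      exact hdisj _ _ _ hp' hp
    refine h1.trans (Finset.card_pos.2 ⟨q, ?_⟩)
    simp only [mem_filter, hqU, true_and, mem_edgeCut, mem_singleton]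
    rcases Sym2.eq_iff.1 hpq with ⟨h1, h2⟩ | ⟨h1, h2⟩ <;> simp [h1, h2, hne]
  rcases Finset.eq_empty_or_nonempty {c ∈ C | e ∈ edgeCut s t (S c)} with h0 | ⟨c, hc⟩
  · simp [h0]
  · have hc := mem_edgeCut.1 (mem_filter.1 hc).2
    by_cases hp : s e ∈ S c
    · exact aux _ _ rfl c hp (by tauto)
    · exact aux (t e) (s e) Sym2.eq_swap c (by tauto) hp

variable [Fintype V]

lemma edgeCut_compl (S : Finset V) : edgeCut s t Sᶜ = edgeCut s t S := by
  ext e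
  simp only [mem_edgeCut, mem_compl]
  tauto

/-- The simple graph of the pairs of distinct vertices that are joined by an edge of positive
weight. -/
def supportGraph (s t : E → V) (x : E → ℚ) : SimpleGraph V where
  Adj u v := u ≠ v ∧ ∃ e, 0 < x e ∧ s(s e, t e) = s(u, v)
  symm.symm _ _ h := ⟨h.1.symm, by simpa only [Sym2.eq_swap] using h.2⟩
  loopless.irrefl _ h := h.1 rfl

/-- The vertices of a component of `G - U`, as vertices of `G`. -/
noncomputable def componentVerts {G : SimpleGraph V} {U : Set V}
    (c : ((⊤ : G.Subgraph).deleteVerts U).coe.ConnectedComponent) : Finset V :=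
  (Subtype.val '' c.supp).toFinset

lemma mem_componentVerts {G : SimpleGraph V} {U : Set V}
    {c : ((⊤ : G.Subgraph).deleteVerts U).coe.ConnectedComponent} {p : V} :
    p ∈ componentVerts c ↔ ∃ hp : p ∈ ((⊤ : G.Subgraph).deleteVerts U).verts,
      SimpleGraph.connectedComponentMk _ ⟨p, hp⟩ = c := by
  simp [componentVerts]

lemma notMem_of_mem_componentVerts {G : SimpleGraph V} {U : Set V}
    {c : ((⊤ : G.Subgraph).deleteVerts U).coe.ConnectedComponent} {p : V}
    (hp : p ∈ componentVerts c) : p ∉ U := by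
  obtain ⟨hp, -⟩ := mem_componentVerts.1 hp
  simpa using hp

lemma componentVerts_disjoint {G : SimpleGraph V} {U : Set V}
    {c c' : ((⊤ : G.Subgraph).deleteVerts U).coe.ConnectedComponent} {p : V}
    (hp : p ∈ componentVerts c) (hp' : p ∈ componentVerts c') : c = c' := by
  obtain ⟨_, h1⟩ := mem_componentVerts.1 hp
  obtain ⟨_, h2⟩ := mem_componentVerts.1 hp'
  rw [← h1, ← h2]

/-- A neighbour of a component of `G - U` outside the component lies in `U`. -/
lemma mem_of_adj_of_notMem_componentVerts {G : SimpleGraph V} {U : Set V}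
    {c : ((⊤ : G.Subgraph).deleteVerts U).coe.ConnectedComponent} {p q : V}
    (hp : p ∈ componentVerts c) (hq : q ∉ componentVerts c) (hadj : G.Adj p q) : q ∈ U := by
  by_contra hqU
  have hpU := notMem_of_mem_componentVerts hp
  obtain ⟨hpV, rfl⟩ := mem_componentVerts.1 hp
  have hqV : q ∈ ((⊤ : G.Subgraph).deleteVerts U).verts := by simpa using hqU
  refine hq (mem_componentVerts.2 ⟨hqV, ?_⟩)
  rw [SimpleGraph.ConnectedComponent.eq]
  refine SimpleGraph.Adj.reachable ?_
  simp [hpU, hqU, hadj.symm]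

/-- Counting the weight of the edges between a vertex set `U` and the odd components of its
complement in two ways shows that there are at most `|U|` of these components. -/
lemma OddCutCondition.not_isTutteViolator (h : OddCutCondition s t x r) (hr : 0 < r) (U : Set V) :
    ¬ (supportGraph s t x).IsTutteViolator U := by
  intro hU
  rw [SimpleGraph.IsTutteViolator] at hU
  let C := ((⊤ : (supportGraph s t x).Subgraph).deleteVerts U).coe.oddComponents.toFinset
  have hle : r * #C ≤ r * #U.toFinset := calc
    r * #C = ∑ c ∈ C, r := by simp [mul_comm]
    _ ≤ ∑ c ∈ C, ∑ e ∈ edgeCut s t (componentVerts c), x e := by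
      refine Finset.sum_le_sum fun c hc => h.odd_cut _ ?_
      have hc : Odd c.supp.ncard := by simpa [C] using hc
      rwa [← Set.ncard_image_of_injective _ Subtype.val_injective,
        Set.ncard_eq_toFinset_card'] at hc
    _ = ∑ e, x e * #{c ∈ C | e ∈ edgeCut s t (componentVerts c)} := sum_sum_edgeCut _ _
    _ ≤ ∑ e, x e * #{v ∈ U.toFinset | e ∈ edgeCut s t {v}} := by
      refine Finset.sum_le_sum fun e _ => ?_
      rcases (h.nonneg e).eq_or_lt with h0 | h0
      · simp [← h0]
      · have := card_filter_mem_edgeCut_le C componentVerts U.toFinset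
          (fun c c' p hp hp' => componentVerts_disjoint hp hp')
          (fun c p hp => by simpa using notMem_of_mem_componentVerts hp) (e := e) (s := s) (t := t)
          fun c p q hpq hp hq => by
            have hne : p ≠ q := by rintro rfl; exact hq hp
            simpa using mem_of_adj_of_notMem_componentVerts hp hq ⟨hne, e, h0, hpq⟩
        exact mul_le_mul_of_nonneg_left (by exact_mod_cast this) h0.le
    _ = ∑ v ∈ U.toFinset, ∑ e ∈ edgeCut s t {v}, x e := (sum_sum_edgeCut _ _).symm
    _ = r * #U.toFinset := by simp [h.degree, mul_comm]
  have hle' : #C ≤ #U.toFinset := by exact_mod_cast le_of_mul_le_mul_left hle hr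
  rw [Set.ncard_eq_toFinset_card', Set.ncard_eq_toFinset_card'] at hU
  exact absurd hU (not_lt.2 hle')

/-- A perfect matching of the support graph lifts to a perfect matching by edges of positive
weight. -/
lemma OddCutCondition.exists_isPerfectMatching (h : OddCutCondition s t x r) (hr : 0 < r) :
    ∃ M, IsPerfectMatching s t M ∧ ∀ e ∈ M, 0 < x e := by
  obtain ⟨N, hN⟩ := SimpleGraph.tutte.2 (h.not_isTutteViolator hr)
  have hex (p : Sym2 V) : ∃ e, p ∈ N.edgeSet → 0 < x e ∧ s(s e, t e) = p := by
    by_cases hp : p ∈ N.edgeSet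
    · induction p with | _ a b
      obtain ⟨e, he⟩ := (N.adj_sub hp).2
      exact ⟨e, fun _ => he⟩
    · by_cases hE : Nonempty E
      · exact ⟨hE.some, fun h => absurd h hp⟩
      · refine absurd ?_ hr.ne
        have : IsEmpty E := not_nonempty_iff.1 hE
        induction p with | _ a b
        simpa [Finset.eq_empty_of_isEmpty] using h.degree a
  choose g hg using hex
  -- `g` selects one of the parallel edges of positive weight for every matched pair
  refine ⟨univ.filter fun e => s(s e, t e) ∈ N.edgeSet ∧ g s(s e, t e) = e, fun v => ?_, ?_⟩
  · obtain ⟨w, hw, huniq⟩ := hN.1 (hN.2 v)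
    have hvw : v ≠ w := hw.ne
    have hgw := hg s(v, w) hw
    rw [Finset.card_eq_one]
    refine ⟨g s(v, w), ?_⟩
    ext e
    simp only [mem_inter, mem_filter, mem_univ, true_and, mem_edgeCut, mem_singleton]
    constructor
    · rintro ⟨⟨h1, h2⟩, h3⟩
      rw [← h2]
      congr 1
      by_cases hs : s e = v
      · rw [hs] at h1 ⊢
        rw [show t e = w from huniq _ h1]
      · have ht : t e = v := by tauto
        rw [ht, Sym2.eq_swap] at h1 ⊢
        rw [show s e = w from huniq _ h1]
    · rintro rfl
      rw [hgw.2]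
      refine ⟨⟨hw, rfl⟩, ?_⟩
      rcases Sym2.eq_iff.1 hgw.2 with ⟨h1, h2⟩ | ⟨h1, h2⟩ <;> simp [h1, h2, hvw.symm]
  · intro e he
    simp only [mem_filter, mem_univ, true_and] at he
    have := (hg _ he.1).1
    rwa [he.2] at this

end PerfectMatchings

/-! ### Contracting and gluing along tight cuts -/

section TightCuts

open Finset
open scoped Classical

universe u v

variable {V : Type u} {E : Type v} {s t : E → V} {x : E → ℚ} {r : ℚ}

/-- The map that contracts the vertex set `S` to the single point `none`. -/
noncomputable def contract (S : Finset V) (v : V) : Option {v // v ∉ S} :=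
  if h : v ∈ S then none else some ⟨v, h⟩

lemma contract_ne_contract {S : Finset V} {a b : V} (hab : a ≠ b) (h : ¬ (a ∈ S ∧ b ∈ S)) :
    contract S a ≠ contract S b := by
  by_cases ha : a ∈ S <;> by_cases hb : b ∈ S <;> simp_all [contract]

/-- Two weight families with the same induced weights on labels have a coupling that is supported on
pairs with equal labels; this computes its first marginal. -/
lemma sum_coupling {ι κ : Type*} [Fintype ι] [Fintype κ] {c : ι → ℚ} {d : κ → ℚ} {a : ι → E}
    {b : κ → E} (hc : ∀ i, 0 ≤ c i) (h1 : ∀ i, x (a i) = ∑ i' with a i' = a i, c i')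
    (h2 : ∀ i, x (a i) = ∑ j with b j = a i, d j) (P : ι → Prop) [DecidablePred P] :
    ∑ p : {p : ι × κ // a p.1 = b p.2} with P p.1.1, c p.1.1 * d p.1.2 / x (a p.1.1) =
      ∑ i with P i, c i := by
  rw [Finset.sum_filter, ← Finset.sum_subtype {p : ι × κ | a p.1 = b p.2} (by simp)
    (fun p : ι × κ => if P p.1 then c p.1 * d p.2 / x (a p.1) else 0), Finset.sum_filter,
    Fintype.sum_prod_type, Finset.sum_filter]
  refine Finset.sum_congr rfl fun i _ => ?_
  dsimp only
  split_ifs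
  · rw [← Finset.sum_filter, ← Finset.sum_div, ← Finset.mul_sum]
    have : ∑ j with a i = b j, d j = x (a i) := by simp only [h2, eq_comm]
    rw [this]
    by_cases h0 : x (a i) = 0
    · -- a label of weight zero carries only zero weights
      have : c i ≤ x (a i) := by
        rw [h1]
        exact Finset.single_le_sum (fun i' _ => hc i') (by simp)
      rw [le_antisymm (h0 ▸ this) (hc i)]
      simp
    · rw [mul_div_assoc, div_self h0, mul_one]
  · simp

variable [Fintype V] [Fintype E]

lemma edgeCut_comp {W : Type*} (q : V → W) (T : Finset W) :
    edgeCut (q ∘ s) (q ∘ t) T = edgeCut s t {v | q v ∈ T} := by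
  ext e
  simp [mem_edgeCut]

lemma odd_card_preimage_iff {W : Type*} {q : V → W} (hq : ∀ w, Odd #{v | q v = w})
    (T : Finset W) : Odd #{v | q v ∈ T} ↔ Odd #T := by
  rw [card_eq_sum_card_fiberwise (f := q) (t := T) (fun v hv => by simpa using hv),
    Finset.odd_sum_iff_odd_card_odd]
  suffices {w ∈ T | Odd #{v ∈ ({v | q v ∈ T} : Finset V) | q v = w}} = T by rw [this]
  refine Finset.filter_true_of_mem fun w hw => ?_
  convert hq w using 2
  ext v
  simp only [mem_filter, mem_univ, true_and, and_iff_right_iff_imp]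
  rintro rfl
  exact hw

lemma filter_contract_eq_none (S : Finset V) [DecidablePred fun v => contract S v = none] :
    ({v | contract S v = none} : Finset V) = S := by
  ext v
  by_cases hv : v ∈ S <;> simp [contract, hv]

lemma filter_contract_eq_some {S : Finset V} (u : {v // v ∉ S})
    [DecidablePred fun v => contract S v = some u] :
    ({v | contract S v = some u} : Finset V) = {u.1} := by
  ext v
  by_cases hv : v ∈ S
  · have : v ≠ u := by rintro rfl; exact u.2 hv
    simp [contract, hv, this]
  · simp [contract, hv, Subtype.ext_iff]

lemma card_contract_lt {S : Finset V} (hS : 1 < #S) :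
    Fintype.card (Option {v // v ∉ S}) < Fintype.card V := by
  have h1 := Finset.card_le_univ S
  have h2 : Fintype.card {v // v ∉ S} = Fintype.card V - #S := by
    simp [Fintype.card_subtype_compl]
  rw [Fintype.card_option, h2]
  omega

lemma OddCutCondition.contract (h : OddCutCondition s t x r) {S : Finset V} (hS : Odd #S)
    (htight : ∑ e ∈ edgeCut s t S, x e = r) :
    OddCutCondition (contract S ∘ s) (_root_.contract S ∘ t) x r where
  nonneg := h.nonneg
  degree := by
    rintro (_ | u)
    · simp only [edgeCut_comp, mem_singleton, filter_contract_eq_none, htight]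
    · simp only [edgeCut_comp, mem_singleton, filter_contract_eq_some, h.degree]
  odd_cut T hT := by
    rw [edgeCut_comp]
    refine h.odd_cut _ ((odd_card_preimage_iff ?_ T).2 hT)
    rintro (_ | u)
    · rwa [filter_contract_eq_none]
    · simp [filter_contract_eq_some]

/-- A combination of perfect matchings of the graph with `S` contracted, described in the original
graph. -/
lemma IsMatchingCombination.of_contract {S : Finset V}
    (h : IsMatchingCombination (contract S ∘ s) (contract S ∘ t) x) :
    ∃ (ι : Type) (_ : Fintype ι) (M : ι → Finset E) (c : ι → ℚ) (a : ι → E), (∀ i, 0 ≤ c i) ∧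
      (∀ i, M i ∩ edgeCut s t S = {a i}) ∧ (∀ i, ∀ v ∉ S, #(M i ∩ edgeCut s t {v}) = 1) ∧
      ∀ e, s e ≠ t e → ¬ (s e ∈ S ∧ t e ∈ S) → x e = ∑ i with e ∈ M i, c i := by
  obtain ⟨ι, _, M, c, hc, hM, hx⟩ := h
  have hMS (i : ι) : ∃ a, M i ∩ edgeCut s t S = {a} := by
    have := hM i none
    simp only [edgeCut_comp, mem_singleton, filter_contract_eq_none] at this
    exact card_eq_one.1 this
  choose a ha using hMS
  refine ⟨ι, _, M, c, a, hc, ha, fun i v hv => ?_, fun e he heS =>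
    hx e (contract_ne_contract he heS)⟩
  have := hM i (some ⟨v, hv⟩)
  simpa only [edgeCut_comp, mem_singleton, filter_contract_eq_some] using this

/-- Combinations of perfect matchings for the contractions of `S` and of its complement can be
combined to perfect matchings of the whole graph. A perfect matching of either contraction contains
exactly one edge of the cut, because this cut is the star of the contracted vertex; both
combinations use each cut edge with the same weight, so matchings with the same cut edge can be
paired and glued. -/
lemma isMatchingCombination_of_contract {S : Finset V}
    (h1 : IsMatchingCombination (contract S ∘ s) (contract S ∘ t) x)
    (h2 : IsMatchingCombination (contract Sᶜ ∘ s) (contract Sᶜ ∘ t) x) :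
    IsMatchingCombination s t x := by
  obtain ⟨ι, _, M, c, a, hc, ha, hM, hx⟩ := h1.of_contract
  obtain ⟨κ, _, N, d, b, hd, hb, hN, hy⟩ := h2.of_contract
  simp only [edgeCut_compl, mem_compl, not_not] at hb hN hy
  have hcut {e : E} (he : e ∈ edgeCut s t S) :
      s e ≠ t e ∧ ¬ (s e ∈ S ∧ t e ∈ S) ∧ ¬ (s e ∉ S ∧ t e ∉ S) := by
    rw [mem_edgeCut] at he
    exact ⟨fun h => he (by rw [h]), by tauto, by tauto⟩
  have haM (i : ι) : a i ∈ M i ∩ edgeCut s t S := by rw [ha]; exact mem_singleton_self _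
  have hbN (j : κ) : b j ∈ N j ∩ edgeCut s t S := by rw [hb]; exact mem_singleton_self _
  have hMa {e : E} (he : e ∈ edgeCut s t S) (i : ι) : e ∈ M i ↔ a i = e := by
    rw [← mem_singleton.trans eq_comm, ← ha]; simp [he]
  have hNb {e : E} (he : e ∈ edgeCut s t S) (j : κ) : e ∈ N j ↔ b j = e := by
    rw [← mem_singleton.trans eq_comm, ← hb]; simp [he]
  have hxa {e : E} (he : e ∈ edgeCut s t S) : x e = ∑ i with a i = e, c i := by
    rw [hx e (hcut he).1 (hcut he).2.1]; simp only [hMa he]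
  have hxb {e : E} (he : e ∈ edgeCut s t S) : x e = ∑ j with b j = e, d j := by
    rw [hy e (hcut he).1 (hcut he).2.2]; simp only [hNb he]
  have haS (i : ι) := (mem_inter.1 (haM i)).2
  have hbS (j : κ) := (mem_inter.1 (hbN j)).2
  -- outside `S` and on the cut, a glued matching follows `M i`, and inside `S` it follows `N j`
  refine ⟨{p : ι × κ // a p.1 = b p.2}, inferInstance,
    fun p => {e ∈ M p.1.1 | ¬ (s e ∈ S ∧ t e ∈ S)} ∪ {e ∈ N p.1.2 | s e ∈ S ∧ t e ∈ S},
    fun p => c p.1.1 * d p.1.2 / x (a p.1.1), ?_, ?_, ?_⟩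
  · intro p
    refine div_nonneg (mul_nonneg (hc _) (hd _)) ?_
    rw [hxa (haS _)]
    exact Finset.sum_nonneg fun i _ => hc i
  · rintro ⟨⟨i, j⟩, hij⟩ v
    have hij : a i = b j := hij
    by_cases hv : v ∈ S
    · rw [← hN j v hv]
      congr 1
      ext e
      simp only [mem_inter, mem_union, mem_filter]
      refine and_congr_left fun he => ?_
      have hS' : s e ∈ S ∨ t e ∈ S := by
        rw [mem_edgeCut, mem_singleton, mem_singleton] at he
        by_cases h : s e = v
        · exact .inl (h ▸ hv)
        · exact .inr (by rw [show t e = v by tauto]; exact hv)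
      by_cases heS : s e ∈ S ∧ t e ∈ S
      · simp [heS]
      · have heS' : e ∈ edgeCut s t S := by rw [mem_edgeCut]; tauto
        simp [heS, hMa heS', hNb heS', hij]
    · rw [← hM i v hv]
      congr 1
      ext e
      simp only [mem_inter, mem_union, mem_filter]
      refine and_congr_left fun he => ?_
      have heS : ¬ (s e ∈ S ∧ t e ∈ S) := by
        rintro ⟨h1, h2⟩
        rw [mem_edgeCut, mem_singleton, mem_singleton] at he
        by_cases h : s e = v
        · exact hv (h ▸ h1)
        · exact hv ((show t e = v by tauto) ▸ h2)
      simp [heS]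
  · intro e he
    by_cases heS : s e ∈ S ∧ t e ∈ S
    · have h0 : ¬ (s e ∉ S ∧ t e ∉ S) := by tauto
      rw [hy e he h0, ← sum_coupling (a := b) (b := a) hd (fun j => hxb (hbS j))
        (fun j => hxa (hbS j)) (fun j => e ∈ N j)]
      refine Finset.sum_equiv ((Equiv.prodComm κ ι).subtypeEquiv fun p => eq_comm) ?_ ?_
      · simp only [mem_filter, mem_univ, true_and, mem_union, heS, and_self, not_true, and_false,
          and_true, false_or]
        exact fun _ => Iff.rfl
      · rintro ⟨⟨j, i⟩, hij⟩ -
        have hij : b j = a i := hij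
        change d j * c i / x (b j) = c i * d j / x (a i)
        rw [hij, mul_comm]
    · rw [hx e he heS, ← sum_coupling (a := a) (b := b) hc (fun i => hxa (haS i))
        (fun i => hxb (haS i)) (fun i => e ∈ M i)]
      refine Finset.sum_congr ?_ fun _ _ => rfl
      ext p
      simp only [mem_filter, mem_univ, true_and, mem_union, heS, not_false_iff, and_false, and_true,
        or_false]

end TightCuts

/-! ### The perfect matching polytope -/

section MatchingPolytope

open Finset
open scoped Classical

universe u v

variable {V : Type u} {E : Type v} {s t : E → V} {x : E → ℚ} {r : ℚ}

lemma sum_sub_indicator (M A : Finset E) (ε : ℚ) :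
    ∑ e ∈ A, (if e ∈ M then x e - ε else x e) = ∑ e ∈ A, x e - ε * #(M ∩ A) := by
  have h (e : E) : (if e ∈ M then x e - ε else x e) = x e - if e ∈ M then ε else 0 := by
    split_ifs <;> simp
  simp_rw [h, Finset.sum_sub_distrib]
  congr 1
  rw [← Finset.sum_filter, Finset.sum_const, nsmul_eq_mul, mul_comm, Finset.filter_mem_eq_inter,
    Finset.inter_comm]

variable [Fintype E]

/-- A set that a perfect matching leaves more than once has at least two vertices. -/
lemma IsPerfectMatching.one_lt_card {M : Finset E} (hM : IsPerfectMatching s t M) {S : Finset V}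
    (hS : 1 < #(M ∩ edgeCut s t S)) : 1 < #S := by
  by_contra hS'
  rcases Nat.le_one_iff_eq_zero_or_eq_one.1 (not_lt.1 hS') with h0 | h1
  · have : edgeCut s t ∅ = ∅ := by ext; simp [mem_edgeCut]
    simp [Finset.card_eq_zero.1 h0, this] at hS
  · obtain ⟨v, rfl⟩ := Finset.card_eq_one.1 h1
    rw [hM v] at hS
    exact lt_irrefl _ hS

lemma IsMatchingCombination.add_indicator {M : Finset E} (hM : IsPerfectMatching s t M) {ε : ℚ}
    (hε : 0 ≤ ε) (h : IsMatchingCombination s t (fun e => if e ∈ M then x e - ε else x e)) :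
    IsMatchingCombination s t x := by
  obtain ⟨ι, _, N, c, hc, hN, hx⟩ := h
  refine ⟨Option ι, inferInstance, fun o => o.elim M N, fun o => o.elim ε c, ?_, ?_, ?_⟩
  · rintro (_ | i)
    exacts [hε, hc i]
  · rintro (_ | i)
    exacts [hM, hN i]
  · intro e he
    have := hx e he
    rw [Finset.sum_filter] at this ⊢
    have key : x e = (if e ∈ M then ε else 0) + ∑ i, if e ∈ N i then c i else 0 := by
      rw [← this]
      dsimp only
      split_ifs <;> ring
    rw [Fintype.sum_option]
    exact key

variable [Fintype V]

/-- Subtract a perfect matching from the weighting with the largest multiplicity that preserves the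
odd cut condition. Then an edge of the matching loses all its weight, or an odd cut that the
matching crosses more than once becomes tight. -/
lemma OddCutCondition.exists_maximal_sub [Nonempty V] (h : OddCutCondition s t x r) {M : Finset E}
    (hM : IsPerfectMatching s t M) : ∃ ε, 0 ≤ ε ∧
      OddCutCondition s t (fun e => if e ∈ M then x e - ε else x e) (r - ε) ∧
      ((∃ e ∈ M, x e = ε) ∨ ∃ S, Odd #S ∧ 1 < #(M ∩ edgeCut s t S) ∧
        ∑ e ∈ edgeCut s t S, (if e ∈ M then x e - ε else x e) = r - ε) := by
  let 𝒮 : Finset (Finset V) := {S | Odd #S ∧ 1 < #(M ∩ edgeCut s t S)}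
  -- `b S` is the multiplicity at which the cut of `S` becomes tight
  let b (S : Finset V) : ℚ := (∑ e ∈ edgeCut s t S, x e - r) / (#(M ∩ edgeCut s t S) - 1)
  let F : Finset ℚ := M.image x ∪ 𝒮.image b
  have hpos {S : Finset V} (hS : S ∈ 𝒮) : (0 : ℚ) < #(M ∩ edgeCut s t S) - 1 := by
    have : (1 : ℚ) < #(M ∩ edgeCut s t S) := by exact_mod_cast (mem_filter.1 hS).2.2
    linarith
  have hF : F.Nonempty := by
    obtain ⟨v⟩ := ‹Nonempty V›
    obtain ⟨e, he⟩ := Finset.card_pos.1 (by rw [hM v]; exact one_pos)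
    exact ⟨x e, mem_union_left _ (mem_image_of_mem _ (mem_inter.1 he).1)⟩
  have hmin {q : ℚ} (hq : q ∈ F) : F.min' hF ≤ q := F.min'_le _ hq
  have hmem := F.min'_mem hF
  set ε := F.min' hF
  have hx {e : E} (he : e ∈ M) : ε ≤ x e := hmin (mem_union_left _ (mem_image_of_mem _ he))
  have hb {S : Finset V} (hS : S ∈ 𝒮) : ε ≤ b S := hmin (mem_union_right _ (mem_image_of_mem _ hS))
  have hε : 0 ≤ ε := by
    simp only [F, mem_union, mem_image] at hmem
    rcases hmem with ⟨e, he, h1⟩ | ⟨S, hS, h1⟩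
    · rw [← h1]; exact h.nonneg e
    · rw [← h1]
      exact div_nonneg (sub_nonneg.2 (h.odd_cut S (mem_filter.1 hS).2.1)) (hpos hS).le
  refine ⟨ε, hε, ⟨fun e => ?_, fun v => ?_, fun S hS => ?_⟩, ?_⟩
  · split_ifs with he
    · exact sub_nonneg.2 (hx he)
    · exact h.nonneg e
  · rw [sum_sub_indicator, h.degree, hM v]
    simp
  · rw [sum_sub_indicator]
    by_cases hS1 : 1 < #(M ∩ edgeCut s t S)
    · have hS' : S ∈ 𝒮 := mem_filter.2 ⟨mem_univ _, hS, hS1⟩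
      have := (le_div_iff₀ (hpos hS')).1 (hb hS')
      linarith
    · have h1 : (#(M ∩ edgeCut s t S) : ℚ) ≤ 1 := by exact_mod_cast not_lt.1 hS1
      have h2 := h.odd_cut S hS
      nlinarith
  · simp only [F, mem_union, mem_image] at hmem
    rcases hmem with ⟨e, he, h1⟩ | ⟨S, hS, h1⟩
    · exact .inl ⟨e, he, h1⟩
    · refine .inr ⟨S, (mem_filter.1 hS).2.1, (mem_filter.1 hS).2.2, ?_⟩
      rw [sum_sub_indicator]
      have := (div_eq_iff (hpos hS).ne').1 h1
      linarith

lemma OddCutCondition.even_card (h : OddCutCondition s t x r) (hr : 0 < r) :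
    Even (Fintype.card V) := by
  by_contra hodd
  have := h.odd_cut univ (by simpa using hodd)
  have h0 : edgeCut s t univ = ∅ := by ext; simp [mem_edgeCut]
  rw [h0, Finset.sum_empty] at this
  linarith

/-- **Edmonds' perfect matching polytope theorem.** A nonnegative edge weighting with constant
weight `r` at the vertices and weight at least `r` on odd cuts is a combination of perfect
matchings. -/
theorem OddCutCondition.isMatchingCombination (h : OddCutCondition s t x r) :
    IsMatchingCombination s t x := by
  induction hn : Fintype.card V using Nat.strong_induction_on generalizing V x r with
  | _ n ihV
  induction hm : #{e | 0 < x e} using Nat.strong_induction_on generalizing x r with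
  | _ m ihE
  rcases isEmpty_or_nonempty V with hV | hV
  · exact ⟨Empty, inferInstance, nofun, nofun, nofun, nofun, fun e => (hV.false (s e)).elim⟩
  rcases le_or_gt r 0 with hr | hr
  · refine ⟨Empty, inferInstance, nofun, nofun, nofun, nofun, fun e he => ?_⟩
    have : x e ≤ ∑ e ∈ edgeCut s t {s e}, x e :=
      Finset.single_le_sum (fun e _ => h.nonneg e) (by simp [mem_edgeCut, he.symm])
    rw [h.degree] at this
    simpa using le_antisymm (this.trans hr) (h.nonneg e)
  obtain ⟨M, hM, hMx⟩ := h.exists_isPerfectMatching hr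
  obtain ⟨ε, hε, hy, htight⟩ := h.exists_maximal_sub hM
  refine IsMatchingCombination.add_indicator hM hε ?_
  rcases htight with ⟨e, he, hxe⟩ | ⟨S, hS, hMS, htight⟩
  · refine ihE _ ?_ hy rfl
    rw [← hm]
    refine Finset.card_lt_card (Finset.ssubset_iff_of_subset ?_ |>.2 ⟨e, ?_, ?_⟩)
    · intro f hf
      simp only [mem_filter, mem_univ, true_and] at hf ⊢
      split_ifs at hf <;> linarith
    · simpa using hMx e he
    · simp [he, hxe]
  · have hSc : Odd #Sᶜ := by
      have := h.even_card hr
      rw [← Finset.card_add_card_compl S, Nat.even_add'] at this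
      exact this.1 hS
    have hMSc : 1 < #(M ∩ edgeCut s t Sᶜ) := by rwa [edgeCut_compl]
    refine isMatchingCombination_of_contract (S := S) ?_ ?_
    · exact ihV _ (hn ▸ card_contract_lt (hM.one_lt_card hMS)) (hy.contract hS htight) rfl
    · exact ihV _ (hn ▸ card_contract_lt (hM.one_lt_card hMSc))
        (hy.contract hSc (by rwa [edgeCut_compl])) rfl

/-- Clearing denominators in a combination of perfect matchings: if the constant weighting `1`
satisfies the odd cut condition, then some finite family of perfect matchings covers every edge
equally often. -/
theorem OddCutCondition.exists_uniform_family (h : OddCutCondition s t (fun _ => 1) r)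
    (hloop : ∀ e, s e ≠ t e) : ∃ (κ : Type) (_ : Fintype κ) (M : κ → Finset E) (N : ℕ),
      0 < N ∧ (∀ i, IsPerfectMatching s t (M i)) ∧ ∀ e, #{i | e ∈ M i} = N := by
  obtain ⟨ι, _, M, c, hc, hM, hx⟩ := h.isMatchingCombination
  let D : ℕ := ∏ i, (c i).den
  have hn (i : ι) : ∃ n : ℕ, (n : ℚ) = c i * D := by
    obtain ⟨m, hm⟩ : (c i).den ∣ D := Finset.dvd_prod_of_mem _ (mem_univ i)
    refine ⟨(c i).num.toNat * m, ?_⟩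
    have h0 : (((c i).num.toNat : ℕ) : ℚ) = (c i).num := by
      exact_mod_cast Int.toNat_of_nonneg (Rat.num_nonneg.2 (hc i))
    rw [hm, Nat.cast_mul, Nat.cast_mul, ← mul_assoc, Rat.mul_den_eq_num, h0]
  choose n hn using hn
  refine ⟨Σ i, Fin (n i), inferInstance, fun p => M p.1, D,
    Finset.prod_pos fun i _ => (c i).den_pos, fun p => hM p.1, fun e => ?_⟩
  have h1 : #{p : Σ i, Fin (n i) | e ∈ M p.1} = ∑ i with e ∈ M i, n i := by
    rw [Finset.card_filter, Fintype.sum_sigma, Finset.sum_filter]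
    refine Finset.sum_congr rfl fun i _ => ?_
    split_ifs <;> simp
  have h2 : ((∑ i with e ∈ M i, n i : ℕ) : ℚ) = D := by
    push_cast
    simp_rw [hn]
    rw [← Finset.sum_mul, ← hx e (hloop e), one_mul]
  rw [h1]
  exact_mod_cast h2

end MatchingPolytope

/-! ### Cycles formed by edge sets with degrees zero and two -/

namespace Graph

open Relation
open scoped Classical

variable {α β : Type*} {G : Graph α β} {F : Set β} {v w : α} {e : β}

/-- The vertices `a` and `b` are joined by an edge in `F`. -/
def AdjIn (G : Graph α β) (F : Set β) (a b : α) : Prop := ∃ e ∈ F, G.IsLink e a b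

lemma AdjIn.symm {a b : α} (h : G.AdjIn F a b) : G.AdjIn F b a :=
  ⟨h.choose, h.choose_spec.1, h.choose_spec.2.symm⟩

lemma reflTransGen_adjIn_symm {a b : α} (h : ReflTransGen (G.AdjIn F) a b) :
    ReflTransGen (G.AdjIn F) b a := by
  induction h with
  | refl => exact .refl
  | tail _ h ih => exact .head h.symm ih

/-- The component of the vertex `v` in the subgraph of `G` with edge set `F`. -/
def componentIn (G : Graph α β) (F : Set β) (v : α) : Graph α β where
  vertexSet := {w | ReflTransGen (G.AdjIn F) v w}
  IsLink e a b := e ∈ F ∧ G.IsLink e a b ∧ ReflTransGen (G.AdjIn F) v a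
  isLink_symm e _ := ⟨fun _ _ h => ⟨h.1, h.2.1.symm, h.2.2.tail ⟨e, h.1, h.2.1⟩⟩⟩
  eq_or_eq_of_isLink_of_isLink _ _ _ _ _ h h' := h.2.1.left_eq_or_eq h'.2.1
  left_mem_of_isLink _ _ _ h := h.2.2

lemma mem_vertexSet_componentIn :
    w ∈ V(G.componentIn F v) ↔ ReflTransGen (G.AdjIn F) v w := Iff.rfl

lemma isLink_componentIn {a b : α} : (G.componentIn F v).IsLink e a b ↔
    e ∈ F ∧ G.IsLink e a b ∧ ReflTransGen (G.AdjIn F) v a := Iff.rfl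

lemma inc_componentIn_iff : (G.componentIn F v).Inc e w ↔
    e ∈ F ∧ G.Inc e w ∧ ReflTransGen (G.AdjIn F) v w := by
  simp only [Graph.Inc, isLink_componentIn]
  tauto

lemma reflTransGen_adjIn_of_inc {a b : α} (he : e ∈ F) (ha : G.Inc e a) (hb : G.Inc e b) :
    ReflTransGen (G.AdjIn F) a b := by
  obtain ⟨c, hc⟩ := ha
  rcases hb.eq_or_eq_of_isLink hc with rfl | rfl
  · exact .refl
  · exact .single ⟨e, he, hc⟩

/-- An edge of `F` lies in the component of `v` if either of its ends does. -/
lemma mem_edgeSet_componentIn_iff (he : G.Inc e w) :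
    e ∈ E(G.componentIn F v) ↔ e ∈ F ∧ ReflTransGen (G.AdjIn F) v w := by
  constructor
  · intro h
    obtain ⟨a, b, hF, hab, ha⟩ := exists_isLink_of_mem_edgeSet h
    exact ⟨hF, ha.trans (reflTransGen_adjIn_of_inc hF hab.inc_left he)⟩
  · rintro ⟨hF, h⟩
    exact (inc_componentIn_iff.2 ⟨hF, he, h⟩).edge_mem

lemma componentIn_congr (h : ReflTransGen (G.AdjIn F) v w) :
    G.componentIn F v = G.componentIn F w := by
  have key (a : α) : ReflTransGen (G.AdjIn F) v a ↔ ReflTransGen (G.AdjIn F) w a :=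
    ⟨fun ha => (reflTransGen_adjIn_symm h).trans ha, fun ha => h.trans ha⟩
  refine Graph.ext (Set.ext key) fun e a b => ?_
  simp only [isLink_componentIn, key]

lemma componentIn_le (hv : v ∈ V(G)) : G.componentIn F v ≤ G where
  vertexSet_mono w hw := by
    rw [mem_vertexSet_componentIn] at hw
    rcases ReflTransGen.cases_tail hw with rfl | ⟨_, -, e, -, h⟩
    exacts [hv, h.right_mem]
  isLink_mono _ _ _ h := h.2.1

lemma componentIn_isConnected : (G.componentIn F v).IsConnected := by
  have key {w : α} (hw : ReflTransGen (G.AdjIn F) v w) :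
      ReflTransGen (G.componentIn F v).Adj v w := by
    induction hw with
    | refl => exact .refl
    | tail h1 h2 ih =>
      obtain ⟨e, he, h⟩ := h2
      exact ih.tail ⟨e, he, h, h1⟩
  have symm {a b : α} (h : ReflTransGen (G.componentIn F v).Adj a b) :
      ReflTransGen (G.componentIn F v).Adj b a := by
    induction h with
    | refl => exact .refl
    | tail _ h ih => exact .head h.symm ih
  exact ⟨⟨v, .refl⟩, fun x hx y hy => (symm (key hx)).trans (key hy)⟩

/-- Every vertex is incident with no edge of `F` or with exactly two, and `F` contains no loop. -/
structure IsTwoRegularEdgeSet (G : Graph α β) (F : Set β) : Prop where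
  encard : ∀ v, ∀ e ∈ F, G.Inc e v → {f | f ∈ F ∧ G.Inc f v}.encard = 2
  not_isLoopAt : ∀ e ∈ F, ∀ v, ¬ G.IsLoopAt e v

lemma IsTwoRegularEdgeSet.isCycle_componentIn (hF : G.IsTwoRegularEdgeSet F) (hfin : V(G).Finite)
    (he : e ∈ F) (hv : G.Inc e v) : (G.componentIn F v).IsCycle := by
  refine ⟨hfin.subset (componentIn_le hv.vertex_mem).vertexSet_mono, componentIn_isConnected,
    fun w hw => ?_⟩
  rw [mem_vertexSet_componentIn] at hw
  have hinc : (G.componentIn F v).incidenceSet w = {f | f ∈ F ∧ G.Inc f w} := by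
    ext f
    simp [inc_componentIn_iff, hw]
  have hloop : (G.componentIn F v).loopSet w = ∅ := by
    ext f
    simp only [mem_loopSet, Set.mem_empty_iff_false, iff_false]
    exact fun h => hF.not_isLoopAt f h.1 w h.2.1
  obtain ⟨f, hf, hfw⟩ : ∃ f ∈ F, G.Inc f w := by
    rcases ReflTransGen.cases_tail hw with rfl | ⟨_, -, f, hf, h⟩
    exacts [⟨e, he, hv⟩, ⟨f, hf, h.inc_right⟩]
  rw [degree, hinc, hloop, hF.encard w f hf hfw, Set.encard_empty]
  rfl

/-- The components, other than isolated vertices, of the subgraph of `G` with edge set `F`. -/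
noncomputable def componentsIn (G : Graph α β) (hfin : V(G).Finite) (F : Set β) :
    Finset (Graph α β) :=
  {v ∈ hfin.toFinset | ∃ e ∈ F, G.Inc e v}.image (G.componentIn F)

lemma IsTwoRegularEdgeSet.le_and_isCycle (hF : G.IsTwoRegularEdgeSet F) (hfin : V(G).Finite)
    {C : Graph α β} (hC : C ∈ G.componentsIn hfin F) : C ≤ G ∧ C.IsCycle := by
  simp only [componentsIn, Finset.mem_image, Finset.mem_filter] at hC
  obtain ⟨v, ⟨-, e, he, hv⟩, rfl⟩ := hC
  exact ⟨componentIn_le hv.vertex_mem, hF.isCycle_componentIn hfin he hv⟩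

/-- Edges with a common end lie together in exactly one component of `F` if all of them are in `F`,
and in none otherwise. -/
lemma countContaining_componentsIn (hfin : V(G).Finite) {A : Set β} (hA : A.Nonempty)
    (hAv : ∀ e ∈ A, G.Inc e v) :
    countContaining (G.componentsIn hfin F).toList A = if A ⊆ F then 1 else 0 := by
  have h1 : countContaining (G.componentsIn hfin F).toList A =
      ((G.componentsIn hfin F).filter fun C => A ⊆ E(C)).card := by
    rw [countContaining, Finset.card_def, Finset.filter_val, ← Multiset.countP_eq_card_filter,
      ← Finset.coe_toList, Multiset.coe_countP]
  have key (w : α) : A ⊆ E(G.componentIn F w) ↔ A ⊆ F ∧ ReflTransGen (G.AdjIn F) w v := by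
    constructor
    · intro h
      refine ⟨fun e he => ((mem_edgeSet_componentIn_iff (hAv e he)).1 (h he)).1, ?_⟩
      obtain ⟨e, he⟩ := hA
      exact ((mem_edgeSet_componentIn_iff (hAv e he)).1 (h he)).2
    · exact fun h e he => (mem_edgeSet_componentIn_iff (hAv e he)).2 ⟨h.1 he, h.2⟩
  rw [h1]
  split_ifs with hAF
  · rw [Finset.card_eq_one]
    refine ⟨G.componentIn F v, ?_⟩
    ext C
    simp only [Finset.mem_filter, Finset.mem_singleton, componentsIn, Finset.mem_image]
    constructor
    · rintro ⟨⟨w, -, rfl⟩, h⟩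
      exact componentIn_congr ((key w).1 h).2
    · rintro rfl
      obtain ⟨e, he⟩ := hA
      exact ⟨⟨v, ⟨by simpa using (hAv e he).vertex_mem, e, hAF he, hAv e he⟩, rfl⟩,
        (key v).2 ⟨hAF, .refl⟩⟩
  · rw [Finset.card_eq_zero]
    refine Finset.filter_eq_empty_iff.2 fun C hC h => hAF ?_
    simp only [componentsIn, Finset.mem_image] at hC
    obtain ⟨w, -, rfl⟩ := hC
    exact ((key w).1 h).1

end Graph

/-! ### Edge-disjoint paths and cuts -/

namespace Graph

variable {α β : Type*} {G : Graph α β} {x y : α} {k : ℕ}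

lemma Walk.exists_crossing_edge (p : G.Walk x y) {P : α → Prop} (hx : P x) (hy : ¬ P y) :
    ∃ e ∈ p.edges, ∃ a b, G.IsLink e a b ∧ P a ∧ ¬ P b := by
  induction p with
  | nil => exact absurd hx hy
  | @cons a b _ e h p ih =>
    by_cases hb : P b
    · obtain ⟨f, hf, hf'⟩ := ih hb hy
      exact ⟨f, List.mem_cons_of_mem _ hf, hf'⟩
    · exact ⟨e, List.mem_cons_self, _, _, h, hx, hb⟩

lemma exists_hasEdgeDisjointPaths (h : G.localEdgeConnectivity x y = k) (hk : 0 < k) :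
    ∃ m, k ≤ m ∧ G.HasEdgeDisjointPaths x y m := by
  by_contra! hcon
  have : G.localEdgeConnectivity x y ≤ (k - 1 : ℕ) := by
    refine iSup₂_le fun m hm => Nat.cast_le.2 ?_
    by_contra hlt
    exact hcon m (by omega) hm
  rw [h, Nat.cast_le] at this
  omega

/-- Edge-disjoint paths cross every separating cut in distinct edges. -/
lemma le_encard_of_localEdgeConnectivity (h : G.localEdgeConnectivity x y = k) (hk : 0 < k)
    {P : α → Prop} (hx : P x) (hy : ¬ P y) :
    (k : ℕ∞) ≤ {e | ∃ a b, G.IsLink e a b ∧ P a ∧ ¬ P b}.encard := by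
  obtain ⟨m, hm, p, -, hdisj⟩ := exists_hasEdgeDisjointPaths h hk
  choose e he hcross using fun i => (p i).exists_crossing_edge hx hy
  have hinj : Function.Injective e := by
    intro i j hij
    by_contra hne
    exact hdisj i j hne (he i) (hij ▸ he j)
  have h1 : (Set.range e).encard = m := by
    rw [← Set.image_univ, hinj.encard_image, Set.encard_univ]
    simp
  calc (k : ℕ∞) ≤ m := Nat.cast_le.2 hm
    _ = (Set.range e).encard := h1.symm
    _ ≤ _ := Set.encard_le_encard (Set.range_subset_iff.2 hcross)

/-- A `k`-regular graph has no loop at `v` if some vertex is joined to `v` by `k` edge-disjoint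
paths: these paths use up the degree of `v`. -/
lemma IsRegular.not_isLoopAt (hreg : G.IsRegular k) (hx : x ∈ V(G)) (hxy : x ≠ y)
    (h : G.localEdgeConnectivity x y = k) (hk : 0 < k) (e : β) : ¬ G.IsLoopAt e x := by
  set A := {e | ∃ a b, G.IsLink e a b ∧ a = x ∧ ¬ b = x} with hA
  have hA' : (k : ℕ∞) ≤ A.encard :=
    le_encard_of_localEdgeConnectivity h hk (P := (· = x)) rfl hxy.symm
  have hdisj : Disjoint A (G.loopSet x) := by
    rw [Set.disjoint_left]
    rintro e ⟨a, b, hab, rfl, hb⟩ he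
    exact hb (IsLink.right_unique hab he)
  have hsub : A ∪ G.loopSet x ⊆ G.incidenceSet x := by
    rintro e (⟨a, b, hab, rfl, -⟩ | he)
    exacts [hab.inc_left, he.inc]
  have hdeg : (G.incidenceSet x).encard + (G.loopSet x).encard = k := hreg x hx
  have h1 := Set.encard_le_encard hsub
  rw [Set.encard_union_eq hdisj] at h1
  have hle : (k : ℕ∞) + (G.loopSet x).encard + (G.loopSet x).encard ≤ k := by
    rw [← hdeg]
    gcongr
    rw [hdeg]
    exact le_trans (by gcongr) h1
  have hfin : (G.loopSet x).encard ≠ ⊤ := by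
    intro htop
    rw [htop] at hle
    simp at hle
  obtain ⟨l, hl⟩ := ENat.ne_top_iff_exists.1 hfin
  rw [← hl] at hle
  have hl0 : l = 0 := by
    have : k + l + l ≤ k := by exact_mod_cast hle
    omega
  rw [hl0, Nat.cast_zero, eq_comm, Set.encard_eq_zero] at hl
  intro he
  have : e ∈ G.loopSet x := he
  rw [hl] at this
  exact this

lemma IsRegular.finite_edgeSet (hreg : G.IsRegular k) (hfin : V(G).Finite) : E(G).Finite := by
  refine (hfin.biUnion (t := G.incidenceSet) fun v hv => ?_).subset fun e he => ?_
  · rw [← Set.encard_lt_top_iff]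
    have h : (G.incidenceSet v).encard + (G.loopSet v).encard = k := hreg v hv
    exact lt_of_le_of_lt (le_self_add.trans h.le) (WithTop.coe_lt_top k)
  · obtain ⟨a, b, hab⟩ := exists_isLink_of_mem_edgeSet he
    exact Set.mem_biUnion hab.left_mem hab.inc_left

end Graph

/-- An involution without fixed points maps some element of any odd set out of the set. -/
lemma exists_apply_notMem_of_odd_card {X : Type*} {μ : X → X} (hμ : Function.Involutive μ)
    (hfix : ∀ v, μ v ≠ v) {S : Finset X} (hS : Odd S.card) : ∃ v ∈ S, μ v ∉ S := by
  by_contra! hcon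
  have h := Finset.sum_involution (s := S) (f := fun _ => (1 : ZMod 2)) (fun v _ => μ v)
    (fun _ _ => by decide) (fun v _ _ => hfix v) hcon (fun v _ => hμ v)
  rw [Finset.sum_const, nsmul_one, ZMod.natCast_eq_zero_iff_even] at h
  exact Nat.not_odd_iff_even.2 h hS

/-! ### Pairs of perfect matchings -/

section Pairs

open Finset
open scoped Classical

lemma card_filter_pair {κ : Type*} [Fintype κ] (P Q : κ → Prop) [DecidablePred P]
    [DecidablePred Q] : #{p : κ × κ | P p.1 ∧ Q p.2} = #{i | P i} * #{i | Q i} := by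
  rw [← Finset.card_product]
  congr 1
  ext
  simp

/-- Edges `e` and `f` that are in no common matching of the family lie together in the symmetric
difference of two matchings exactly if each matching contains one of them. -/
lemma card_filter_mem_symmDiff_pair {E κ : Type*} [Fintype κ] {M : κ → Finset E} {N : ℕ}
    {e f : E} (he : #{i | e ∈ M i} = N) (hf : #{i | f ∈ M i} = N)
    (hef : ∀ i, e ∈ M i → f ∉ M i) :
    #{p : κ × κ | e ∈ symmDiff (M p.1) (M p.2) ∧ f ∈ symmDiff (M p.1) (M p.2)} = 2 * N ^ 2 := by
  have h1 : ({p : κ × κ | e ∈ symmDiff (M p.1) (M p.2) ∧ f ∈ symmDiff (M p.1) (M p.2)} :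
      Finset (κ × κ)) = ({p | e ∈ M p.1 ∧ f ∈ M p.2} : Finset (κ × κ)) ∪
        ({p | f ∈ M p.1 ∧ e ∈ M p.2} : Finset (κ × κ)) := by
    ext p
    simp only [mem_filter, mem_univ, true_and, mem_union, mem_symmDiff]
    have h1 := hef p.1
    have h2 := hef p.2
    tauto
  rw [h1, card_union_of_disjoint, card_filter_pair (fun i => e ∈ M i) (fun i => f ∈ M i),
    card_filter_pair (fun i => f ∈ M i) (fun i => e ∈ M i), he, hf]
  · ring
  · rw [Finset.disjoint_left]
    intro p hp hp'
    simp only [mem_filter, mem_univ, true_and] at hp hp'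
    exact hef p.1 hp.1 hp'.1

lemma card_filter_mem_symmDiff {E κ : Type*} [Fintype κ] {M : κ → Finset E} {N : ℕ}
    {e : E} (he : #{i | e ∈ M i} = N) :
    #{p : κ × κ | e ∈ symmDiff (M p.1) (M p.2)} = 2 * (N * (Fintype.card κ - N)) := by
  have h1 : ({p : κ × κ | e ∈ symmDiff (M p.1) (M p.2)} : Finset (κ × κ)) =
      ({p | e ∈ M p.1 ∧ e ∉ M p.2} : Finset (κ × κ)) ∪
        ({p | e ∉ M p.1 ∧ e ∈ M p.2} : Finset (κ × κ)) := by
    ext p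
    simp only [mem_filter, mem_univ, true_and, mem_union, mem_symmDiff]
    tauto
  have h2 : #{i | e ∉ M i} = Fintype.card κ - N := by
    have := Finset.card_filter_add_card_filter_not (s := (univ : Finset κ)) (fun i => e ∈ M i)
    rw [he, card_univ] at this
    omega
  rw [h1, card_union_of_disjoint, card_filter_pair (fun i => e ∈ M i) (fun i => e ∉ M i),
    card_filter_pair (fun i => e ∉ M i) (fun i => e ∈ M i), he, h2]
  · ring
  · rw [Finset.disjoint_left]
    intro p hp hp'
    simp only [mem_filter, mem_univ, true_and] at hp hp'
    exact hp'.1 hp.1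

end Pairs

/-! ### Uniform families of perfect matchings in a multigraph -/

namespace Graph

open Finset
open scoped Classical

variable {α β : Type*} {G : Graph α β} {k : ℕ}

/-- `M` is a set of edges of `G` such that every vertex is incident with exactly one of them. -/
def IsPerfectMatchingSet (G : Graph α β) (M : Finset β) : Prop :=
  (∀ e ∈ M, e ∈ E(G)) ∧ ∀ v ∈ V(G), ∃! e, e ∈ M ∧ G.Inc e v

/-- The odd cut condition holds because the fixed-point-free involution maps some vertex of an odd
set `S` out of `S`, and the edge-disjoint paths between the two vertices cross the cut of `S`. -/
theorem exists_uniform_perfectMatchings (hk : 0 < k) (hfin : V(G).Finite) (hreg : G.IsRegular k)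
    (hloop : ∀ e v, ¬ G.IsLoopAt e v)
    (μ : V(G) → V(G)) (hμ : Function.Involutive μ) (hμ_fix : ∀ v, μ v ≠ v)
    (hconn : ∀ v : V(G), G.localEdgeConnectivity v (μ v) = k) :
    ∃ (κ : Type) (_ : Fintype κ) (M : κ → Finset β) (N : ℕ), 0 < N ∧
      (∀ i, G.IsPerfectMatchingSet (M i)) ∧ ∀ e ∈ E(G), #{i | e ∈ M i} = N := by
  have hE := hreg.finite_edgeSet hfin
  have : Fintype V(G) := hfin.fintype
  have : Fintype E(G) := hE.fintype
  choose s' t' hst using fun e : E(G) => exists_isLink_of_mem_edgeSet e.2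
  let s (e : E(G)) : V(G) := ⟨s' e, (hst e).left_mem⟩
  let t (e : E(G)) : V(G) := ⟨t' e, (hst e).right_mem⟩
  have hne (e : E(G)) : s e ≠ t e := by
    intro h
    have h' : s' e = t' e := congrArg Subtype.val h
    exact hloop e (s' e) (by have := hst e; rwa [← h'] at this)
  have hcut (S : Finset V(G)) {v : V(G)} (hv : v ∈ S) (hμv : μ v ∉ S) : k ≤ #(edgeCut s t S) := by
    have h := le_encard_of_localEdgeConnectivity (hconn v) hk
      (P := fun a => ∃ h : a ∈ V(G), ⟨a, h⟩ ∈ S) ⟨v.2, hv⟩ (by simpa using hμv)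
    have hsub : {e | ∃ a b, G.IsLink e a b ∧ (∃ h : a ∈ V(G), (⟨a, h⟩ : V(G)) ∈ S) ∧
        ¬ ∃ h : b ∈ V(G), (⟨b, h⟩ : V(G)) ∈ S} ⊆ Subtype.val '' (edgeCut s t S : Set E(G)) := by
      rintro e ⟨a, b, hab, ⟨ha, haS⟩, hb⟩
      refine ⟨⟨e, hab.edge_mem⟩, ?_, rfl⟩
      have hbS : (⟨b, hab.right_mem⟩ : V(G)) ∉ S := fun h => hb ⟨_, h⟩
      rw [mem_coe, mem_edgeCut]
      rcases (hst ⟨e, hab.edge_mem⟩).eq_and_eq_or_eq_and_eq hab with ⟨h1, h2⟩ | ⟨h1, h2⟩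
      · simp [s, t, h1, h2, haS, hbS]
      · simp [s, t, h1, h2, haS, hbS]
    have h := h.trans (Set.encard_le_encard hsub)
    rw [Subtype.val_injective.encard_image, Set.encard_coe_eq_coe_finsetCard] at h
    exact_mod_cast h
  have hinc (e : E(G)) (v : V(G)) : e ∈ edgeCut s t {v} ↔ G.Inc e v := by
    rw [mem_edgeCut, mem_singleton, mem_singleton]
    constructor
    · intro h
      by_cases h1 : s e = v
      · rw [← h1]; exact (hst e).inc_left
      · rw [← show t e = v by tauto]; exact (hst e).inc_right
    · intro h h'
      rcases h.eq_or_eq_of_isLink (hst e) with h1 | h1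
      · have : s e = v := Subtype.ext h1.symm
        exact hne e (this.trans (h'.1 this).symm)
      · have : t e = v := Subtype.ext h1.symm
        exact hne e ((h'.2 this).trans this.symm)
  have hdeg (v : V(G)) : #(edgeCut s t {v}) = k := by
    refine le_antisymm ?_ (hcut _ (mem_singleton_self v) (by simpa using hμ_fix v))
    have h : (G.incidenceSet v).encard + (G.loopSet v).encard = k := hreg v v.2
    have hsub : Subtype.val '' (edgeCut s t {v} : Set E(G)) ⊆ G.incidenceSet v := by
      rintro _ ⟨e, he, rfl⟩
      exact (hinc e v).1 he
    have h := (Set.encard_le_encard hsub).trans (le_self_add.trans h.le)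
    rw [Subtype.val_injective.encard_image, Set.encard_coe_eq_coe_finsetCard] at h
    exact_mod_cast h
  have hodd : OddCutCondition s t (fun _ => 1) k := by
    refine ⟨fun _ => zero_le_one, fun v => by simp [hdeg v], fun S hS => ?_⟩
    obtain ⟨v, hv, hμv⟩ := exists_apply_notMem_of_odd_card hμ hμ_fix hS
    simpa using hcut S hv hμv
  obtain ⟨κ, _, M, N, hN, hM, hcount⟩ := hodd.exists_uniform_family hne
  refine ⟨κ, inferInstance, fun i => (M i).map ⟨Subtype.val, Subtype.val_injective⟩, N, hN,
    fun i => ⟨?_, ?_⟩, fun e he => ?_⟩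
  · simp +contextual
  · intro v hv
    obtain ⟨e, he⟩ := (hM i).exists_forall_mem_iff ⟨v, hv⟩
    have key (f : E(G)) : f ∈ M i ∧ G.Inc f v ↔ f = e := by
      have := he f
      rwa [hinc] at this
    refine ⟨e, ⟨by simpa using ((key e).2 rfl).1, ((key e).2 rfl).2⟩, ?_⟩
    rintro f ⟨hf, hfv⟩
    obtain ⟨f, hfM, rfl⟩ := Finset.mem_map.1 hf
    exact congrArg Subtype.val ((key f).1 ⟨hfM, hfv⟩)
  · rw [← hcount ⟨e, he⟩]
    congr 1
    ext i
    simp [he]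

lemma IsPerfectMatchingSet.isTwoRegularEdgeSet_symmDiff {M M' : Finset β}
    (hM : G.IsPerfectMatchingSet M) (hM' : G.IsPerfectMatchingSet M')
    (hloop : ∀ e v, ¬ G.IsLoopAt e v) :
    G.IsTwoRegularEdgeSet (symmDiff M M' : Finset β) where
  encard v e he hv := by
    obtain ⟨a, ⟨ha, hav⟩, haM⟩ := hM.2 v hv.vertex_mem
    obtain ⟨b, ⟨hb, hbv⟩, hbM⟩ := hM'.2 v hv.vertex_mem
    have hab : a ≠ b := by
      rintro rfl
      rcases Finset.mem_symmDiff.1 (mem_coe.1 he) with ⟨h1, h2⟩ | ⟨h1, h2⟩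
      · exact h2 (haM e ⟨h1, hv⟩ ▸ hb)
      · exact h2 (hbM e ⟨h1, hv⟩ ▸ ha)
    have haM' : a ∉ M' := fun h => hab (hbM a ⟨h, hav⟩)
    have hbM' : b ∉ M := fun h => hab (haM b ⟨h, hbv⟩).symm
    rw [← Set.encard_pair hab]
    congr 1
    ext f
    simp only [mem_coe, Finset.mem_symmDiff, Set.mem_ofPred_eq, Set.mem_insert_iff,
      Set.mem_singleton_iff]
    constructor
    · rintro ⟨⟨h1, -⟩ | ⟨h1, -⟩, hf⟩
      exacts [.inl (haM f ⟨h1, hf⟩), .inr (hbM f ⟨h1, hf⟩)]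
    · rintro (rfl | rfl)
      exacts [⟨.inl ⟨ha, haM'⟩, hav⟩, ⟨.inr ⟨hb, hbM'⟩, hbv⟩]
  not_isLoopAt e _ v := hloop e v

/-- The number of cycles through all edges of `A`, among the cycles formed by all pairs of
matchings of a family. -/
lemma countContaining_flatMap_componentsIn {κ : Type*} [Fintype κ] (hfin : V(G).Finite)
    (M : κ → Finset β) {A : Set β} (hA : A.Nonempty) {v : α} (hAv : ∀ e ∈ A, G.Inc e v) :
    countContaining ((univ : Finset (κ × κ)).toList.flatMap fun p =>
      (G.componentsIn hfin (symmDiff (M p.1) (M p.2) : Finset β)).toList) A =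
      #{p : κ × κ | A ⊆ (symmDiff (M p.1) (M p.2) : Finset β)} := by
  rw [countContaining, List.countP_flatMap, Finset.sum_map_toList, Finset.card_filter]
  exact Finset.sum_congr rfl fun p _ => countContaining_componentsIn hfin hA hAv

/-- A regular graph of degree greater than one has two edges at every vertex, if it has no loops. -/
lemma IsRegular.exists_edgeAdj (hreg : G.IsRegular k) (hk : 1 < k) (hloop : ∀ e v, ¬ G.IsLoopAt e v)
    {v : α} (hv : v ∈ V(G)) : ∃ e f, G.EdgeAdj e f := by
  have h : (G.incidenceSet v).encard + (G.loopSet v).encard = k := hreg v hv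
  have h0 : G.loopSet v = ∅ := Set.eq_empty_of_forall_notMem fun e he => hloop e v he
  rw [h0, Set.encard_empty, add_zero] at h
  have h1 : 1 < (G.incidenceSet v).encard := by rw [h]; exact_mod_cast hk
  obtain ⟨e, f, he, hf, hef⟩ := Set.one_lt_encard_iff.1 h1
  exact ⟨e, f, hef, v, he, hf⟩

end Graph

theorem mainTheorem3 {α β : Type*} (k : ℕ) (hk : 1 < k) (G : Graph α β)
    (hfin : V(G).Finite) (hne : V(G).Nonempty) (hreg : G.IsRegular k)
    (μ : V(G) → V(G)) (hμ : Function.Involutive μ) (hμ_fix : ∀ v, μ v ≠ v)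
    (hconn : ∀ v : V(G), G.localEdgeConnectivity v (μ v) = k) :
    ∃ (L : List (Graph α β)) (m₁ m₂ : ℕ),
      L ≠ [] ∧ (∀ C ∈ L, C ≤ G ∧ C.IsCycle) ∧ 0 < m₁ ∧ 0 < m₂ ∧
      (∀ e ∈ E(G), Graph.countContaining L {e} = m₁) ∧
      (∀ e f, G.EdgeAdj e f → Graph.countContaining L {e, f} = m₂) := by
  classical
  have hk0 : 0 < k := one_pos.trans hk
  have hloop (e : β) (v : α) : ¬ G.IsLoopAt e v := fun h =>
    hreg.not_isLoopAt h.vertex_mem (fun h' => hμ_fix ⟨v, h.vertex_mem⟩ (Subtype.ext h'.symm))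
      (hconn ⟨v, h.vertex_mem⟩) hk0 e h
  obtain ⟨κ, _, M, N, hN, hM, hcount⟩ :=
    Graph.exists_uniform_perfectMatchings hk0 hfin hreg hloop μ hμ hμ_fix hconn
  -- adjacent edges are in no common perfect matching
  have hexcl {e f : β} (hef : G.EdgeAdj e f) (i : κ) (he : e ∈ M i) : f ∉ M i := by
    obtain ⟨hne, v, hev, hfv⟩ := hef
    exact fun hf => hne (((hM i).2 v hev.vertex_mem).unique ⟨he, hev⟩ ⟨hf, hfv⟩)
  set L := (Finset.univ : Finset (κ × κ)).toList.flatMap fun p =>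
      (G.componentsIn hfin (symmDiff (M p.1) (M p.2) : Finset β)).toList with hL
  have hpair (e f : β) (hef : G.EdgeAdj e f) : Graph.countContaining L {e, f} = 2 * N ^ 2 := by
    obtain ⟨-, v, hev, hfv⟩ := id hef
    rw [hL, Graph.countContaining_flatMap_componentsIn hfin M (v := v) ⟨e, by simp⟩
      (by simp [hev, hfv]), ← card_filter_mem_symmDiff_pair (hcount e hev.edge_mem)
      (hcount f hfv.edge_mem) (hexcl hef)]
    congr 1
    ext p
    simp only [Finset.mem_filter, Set.insert_subset_iff, Set.singleton_subset_iff, Finset.mem_coe]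
  have hsingle (e : β) (he : e ∈ E(G)) :
      Graph.countContaining L {e} = 2 * (N * (Fintype.card κ - N)) := by
    obtain ⟨v, w, hvw⟩ := Graph.exists_isLink_of_mem_edgeSet he
    rw [hL, Graph.countContaining_flatMap_componentsIn hfin M (v := v) ⟨e, by simp⟩
      (by simp [hvw.inc_left]), ← card_filter_mem_symmDiff (hcount e he)]
    congr 1
    ext p
    simp only [Finset.mem_filter, Set.singleton_subset_iff, Finset.mem_coe]
  obtain ⟨v, hv⟩ := hne
  obtain ⟨e, f, hef⟩ := hreg.exists_edgeAdj hk hloop hv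
  have hcard : N < Fintype.card κ := by
    obtain ⟨-, w, hew, hfw⟩ := id hef
    have hdisj : Disjoint (Finset.univ.filter fun i => e ∈ M i)
        (Finset.univ.filter fun i => f ∈ M i) := by
      rw [Finset.disjoint_filter]
      exact fun i _ => hexcl hef i
    have h := Finset.card_le_univ (Finset.univ.filter (fun i => e ∈ M i) ∪
      Finset.univ.filter fun i => f ∈ M i)
    rw [Finset.card_union_of_disjoint hdisj, hcount e hew.edge_mem, hcount f hfw.edge_mem] at h
    omega
  refine ⟨L, 2 * (N * (Fintype.card κ - N)), 2 * N ^ 2, ?_, fun C hC => ?_, ?_, by positivity,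
    hsingle, hpair⟩
  · intro h0
    have h := hpair e f hef
    rw [h0, Graph.countContaining, List.countP_nil] at h
    have : 0 < 2 * N ^ 2 := by positivity
    omega
  · simp only [hL, List.mem_flatMap, Finset.mem_toList] at hC
    obtain ⟨p, -, hC⟩ := hC
    exact ((hM p.1).isTwoRegularEdgeSet_symmDiff (hM p.2) hloop).le_and_isCycle hfin hC
  · have := Nat.sub_pos_of_lt hcard
    positivity
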